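/- Let $M$ be a smooth (Hausdorff, finite-dimensional, boundaryless) manifold, $\pi:TM\setminus 0\to M$ its tangent bundle without the zero section, $\mathscr VTM=\ker \mathrm d\pi\to TM\setminus 0$ the vertical bundle, $i_w:T_{\pi(w)}M\to\mathscr V_wTM$, $i_w(u)=\frac{d}{dt}\big|_{t=0}(w+tu)$, the vertical lift, $C(w)=i_w(w)$ the canonical vector field and $\mathscr J(X)=i_w(\mathrm d\pi(X))$ for $X\in T_w(TM\setminus 0)$. Let $S$ be a spray on $M$, i.e. a smooth vector field on $TM\setminus 0$ with $\mathscr J(S)=C$ and $[C,S]=S$, and let $\Gamma_S=-[S,\mathscr J]$, that is $\Gamma_S(X)=-[S,\mathscr JX]+\mathscr J[S,X]$, be its canonical connection; a vector $\xi \in T_w(TM\setminus 0)$ is horizontal if $\Gamma_S\xi=\xi$. A linear connection $\nabla$ on $\mathscr VTM\to TM\setminus 0$ is called a lift of $\Gamma_S$ if $\nabla_XC=X$ for every vertical $X$ and the kernel of $X\mapsto\nabla_XC$ is the horizontal bundle of $\Gamma_S$. Write $\mathcal R(X,Y)Z=\nabla_{[X,Y]}Z-[\nabla_X,\nabla_Y]Z$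 ($Z$ vertical) for its curvature tensor and, for $w\in TM\setminus 0$ and $u\in T_{\pi(w)}M$, define the curvature endomorphism $$\mathbf R_w(u)=i_w^{-1}\,\mathcal R(S,u^{\mathfrak h})C,$$ where $u^{\mathfrak h}\in T_w(TM\setminus 0)$ is the horizontal lift of $u$ and the right-hand side is evaluated at $w$ through an extension of $u^{\mathfrak h}$ to a smooth vector field on $TM\setminus 0$. Then such extensions exist, and $\mathbf R_w(u)$ does not depend on the extension. Moreover, the maps $\mathbf R_w$, $w\in TM\setminus 0$, do not depend on the choice of the lift $\nabla$ of $\Gamma_S$, but only on $S$: any two lifts $\nabla,\nabla'$ of $\Gamma_S$ define the same maps $\mathbf R_w$. Furthermore, if $\nabla$ is a lift of $\Gamma_S$ satisfying (T1) $\nabla_S\mathscr J(Y)-\nabla_Y\mathscr J(S)-\mathscr J[S,Y]=0$ for all smooth vector fields $Y$ on $TM\setminus 0$, then for all $w\in TM\setminus 0$, $u\in T_{\pi(w)}M$ and every smooth vector field $X$ on $TM\setminus 0$ whose value at $w$ is a lift of $u$ (that is, $\mathrm d\pi(X(w))=u$), one has at $w$ $$\mathbf R_w(u)=i_w^{-1}\,\mathcal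 R(S,X)C.$$ -/

import Mathlib

open scoped Manifold ContDiff Topology

noncomputable section

namespace SprayCurvature

variable (E : Type*) [NormedAddCommGroup E] [NormedSpace ℝ E]
  (M : Type*) [TopologicalSpace M] [ChartedSpace E M] [IsManifold 𝓘(ℝ, E) ∞ M]

/-- The slit tangent bundle `TM \ 0`, as an open submanifold of the tangent bundle. -/
def Slit : TopologicalSpace.Opens (TangentBundle 𝓘(ℝ, E) M) where
  carrier := {w | w.2 ≠ 0}
  is_open' := by
    rw [isOpen_iff_mem_nhds]
    intro w hw
    let e := trivializationAt E (TangentSpace 𝓘(ℝ, E) : M → Type _) w.1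
    have he : w ∈ e.source := by
      rw [e.mem_source]; exact FiberBundle.mem_baseSet_trivializationAt' _
    have hlin : ∀ p ∈ e.source, ((e p).2 ≠ 0 ↔ p.2 ≠ 0) := by
      intro p hp
      rw [e.mem_source] at hp
      have h := (e.continuousLinearEquivAt ℝ p.1 hp).map_eq_zero_iff (x := p.2)
      rw [not_iff_not, ← h]
      rfl
    have hcont : ContinuousAt (fun p => (e p).2) w :=
      continuous_snd.continuousAt.comp (e.continuousAt he)
    filter_upwards [e.open_source.mem_nhds he,
      hcont.eventually_ne ((hlin w he).2 hw)] with p hp hp'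
    exact (hlin p hp).1 hp'

/-- Vector fields on `TM \ 0` (no regularity; see `Smooth`). -/
abbrev VField := (w : Slit E M) → TangentSpace 𝓘(ℝ, E).tangent w

variable {E M}

/-- `X` is a smooth vector field on `TM \ 0`. -/
def Smooth (X : VField E M) : Prop :=
  ContMDiff 𝓘(ℝ, E).tangent 𝓘(ℝ, E).tangent.tangent ∞
    (fun w => (⟨w, X w⟩ : TangentBundle 𝓘(ℝ, E).tangent (Slit E M)))

/-- The Lie bracket of vector fields on `TM \ 0`. -/
def bracket (X Y : VField E M) : VField E M :=
  VectorField.mlieBracket 𝓘(ℝ, E).tangent X Y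

/-- The projection `π : TM \ 0 → M`. -/
def proj (w : Slit E M) : M := w.1.1

/-- The differential `dπ(w) : T_w(TM \ 0) → T_{π(w)}M`. -/
def dproj (w : Slit E M) :
    TangentSpace 𝓘(ℝ, E).tangent w →L[ℝ] TangentSpace 𝓘(ℝ, E) (proj w) :=
  mfderiv 𝓘(ℝ, E).tangent 𝓘(ℝ, E) proj w

/-- `X` is vertical, that is a section of `𝒱TM = ker dπ`. -/
def Vertical (X : VField E M) : Prop := ∀ w, dproj w (X w) = 0

/-- The vector `w` itself, as an element of `T_{π(w)}M`. -/
def vec (w : Slit E M) : TangentSpace 𝓘(ℝ, E) (proj w) := w.1.2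

open Classical in
/-- The curve `t ↦ w + t u` in `TM \ 0`, for `u ∈ T_{π(w)}M`. It is the straight line in the
fibre as long as this avoids zero, in particular for all `t` near `0`. -/
def line (w : Slit E M) (u : TangentSpace 𝓘(ℝ, E) (proj w)) (t : ℝ) : Slit E M :=
  if h : vec w + t • u ≠ 0 then ⟨⟨proj w, vec w + t • u⟩, h⟩ else w

theorem line_zero (w : Slit E M) (u : TangentSpace 𝓘(ℝ, E) (proj w)) : line w u 0 = w := by
  have h : vec w + (0 : ℝ) • u = vec w := by rw [zero_smul, add_zero]
  have h' : vec w + (0 : ℝ) • u ≠ 0 := by rw [h]; exact w.2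
  unfold line
  rw [dif_pos h']
  apply Subtype.ext
  show (⟨proj w, vec w + (0 : ℝ) • u⟩ : TangentBundle 𝓘(ℝ, E) M) = w.1
  rw [h]
  rfl

/-- The vertical lift `i_w(u) = (d/dt)|_{t=0} (w + t u)`. -/
def vlift (w : Slit E M) (u : TangentSpace 𝓘(ℝ, E) (proj w)) :
    TangentSpace 𝓘(ℝ, E).tangent w :=
  line_zero w u ▸ mfderiv 𝓘(ℝ, ℝ) 𝓘(ℝ, E).tangent (line w u) 0 (1 : ℝ)

/-! The next facts compute `dπ` and `i_w` in the preferred chart, and show that `i_w` is a bijection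
of `T_{π(w)}M` onto the vertical space `ker dπ(w)`. -/

theorem hval (w : Slit E M) : HasMFDerivAt 𝓘(ℝ, E).tangent 𝓘(ℝ, E).tangent (Subtype.val : Slit E M → _) w
    (ContinuousLinearMap.id ℝ (E × E)) := by
  refine ⟨continuous_subtype_val.continuousAt, ?_⟩
  refine (hasFDerivWithinAt_id (𝕜 := ℝ) _ _).congr_of_eventuallyEq ?_ ?_
  · filter_upwards [extChartAt_target_mem_nhdsWithin (I := 𝓘(ℝ, E).tangent) w] with p hp
    exact (extChartAt 𝓘(ℝ, E).tangent w).right_inv hp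
  · simp only [writtenInExtChartAt, Function.comp]
    rw [extChartAt_to_inv]; rfl

theorem dproj_eq (w : Slit E M) (ξ : E × E) : dproj w ξ = ξ.1 := by
  have h1 := hval w
  have h2 : HasMFDerivAt 𝓘(ℝ, E).tangent 𝓘(ℝ, E) (Bundle.TotalSpace.proj : TangentBundle 𝓘(ℝ, E) M → M) w.1
    (ContinuousLinearMap.fst ℝ E E) := by
    refine ⟨(FiberBundle.continuous_proj E _).continuousAt, ?_⟩
    refine (hasFDerivWithinAt_fst (𝕜 := ℝ)).congr_of_eventuallyEq ?_ ?_
    · filter_upwards [extChartAt_target_mem_nhdsWithin (I := 𝓘(ℝ, E).tangent) w.1] with p hp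
      have := (extChartAt 𝓘(ℝ, E).tangent w.1).right_inv hp
      exact congrArg Prod.fst this
    · simp only [writtenInExtChartAt, Function.comp]
      rw [extChartAt_to_inv]; rfl
  have := (h2.comp w h1).mfderiv
  unfold dproj
  erw [this]
  rfl


def aff0 (a b : E) (t : ℝ) : E := a + t • b
def aff (w : Slit E M) (u : TangentSpace 𝓘(ℝ, E) (proj w)) (t : ℝ) : E := aff0 (E := E) (vec w) u t
theorem aff_cont (a b : E) : Continuous (aff0 a b) := by unfold aff0; fun_prop
theorem aff_deriv (a b : E) : HasFDerivAt (aff0 a b) ((ContinuousLinearMap.id ℝ ℝ).smulRight b) 0 :=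
  ((hasFDerivAt_id (𝕜 := ℝ) (0:ℝ)).smul_const b).const_add _
theorem aff_zero (a b : E) : aff0 a b 0 = a := by simp [aff0]

theorem line_ev (w : Slit E M) (u : TangentSpace 𝓘(ℝ, E) (proj w)) : ∀ᶠ t in 𝓝 (0:ℝ), (line w u t).1 = Bundle.TotalSpace.mk' E (E := (TangentSpace 𝓘(ℝ, E) : M → Type _)) (proj w) (show TangentSpace 𝓘(ℝ, E) (proj w) from aff (E := E) w u t) := by
  have hc : Continuous (aff w u) := aff_cont _ _
  have : aff w u 0 ≠ 0 := by
    have h : aff w u 0 = vec w := aff_zero _ _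
    rw [h]; exact w.2
  filter_upwards [hc.continuousAt.eventually_ne this] with t ht
  unfold line
  split_ifs with h
  · rfl
  · exact absurd ht h

theorem chart_fib (x : M) (v w : E) : extChartAt 𝓘(ℝ, E).tangent (⟨x, w⟩ : TangentBundle 𝓘(ℝ, E) M) ⟨x, v⟩ = (extChartAt 𝓘(ℝ, E) x x, v) := by
  have := tangentCoordChange_self (I := 𝓘(ℝ, E)) (x := x) (z := x) (v := v) (mem_extChartAt_source x)
  exact Prod.ext rfl this

theorem hline (w : Slit E M) (u : TangentSpace 𝓘(ℝ, E) (proj w)) : HasMFDerivAt 𝓘(ℝ, ℝ) 𝓘(ℝ, E).tangent (line w u) 0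
    ((0 : ℝ →L[ℝ] E).prod ((ContinuousLinearMap.id ℝ ℝ).smulRight (show E from u))) := by
  have key : ∀ᶠ t in 𝓝 (0:ℝ), extChartAt 𝓘(ℝ, E).tangent w.1 (line w u t).1 = (extChartAt 𝓘(ℝ, E) w.1.1 w.1.1, aff w u t) := by
    filter_upwards [line_ev w u] with t ht
    rw [ht]; exact chart_fib w.1.1 (aff w u t) (show E from w.1.2)
  have hcv : Continuous (fun t : ℝ => ((extChartAt 𝓘(ℝ, E) w.1.1 w.1.1, aff w u t) : E × E)) := by exact continuous_const.prodMk (aff_cont _ _)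
  refine ⟨?_, ?_⟩
  · rw [ContinuousAt, line_zero, nhds_subtype_eq_comap, Filter.tendsto_comap_iff,
      ]
    have h0 : (fun t : ℝ => ((extChartAt 𝓘(ℝ, E) w.1.1 w.1.1, aff w u t) : E × E)) 0 = extChartAt 𝓘(ℝ, E).tangent w.1 w.1 := by
      have := key.self_of_nhds
      rw [line_zero] at this
      exact this.symm
    have h2 := (continuousAt_extChartAt_symm (I := 𝓘(ℝ, E).tangent) w.1)
    rw [← h0] at h2
    have h3 := ContinuousAt.comp (f := fun t : ℝ => ((extChartAt 𝓘(ℝ, E) w.1.1 w.1.1, aff w u t) : E × E)) h2 hcv.continuousAt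
    rw [ContinuousAt] at h3
    simp only [Function.comp] at h3 
    have h4 := extChartAt_to_inv (I := 𝓘(ℝ, E).tangent) w.1
    rw [← h0] at h4
    simp only at h4
    rw [h4] at h3
    refine h3.congr' ?_
    filter_upwards [key, line_ev w u] with t ht h1
    simp only [Function.comp]
    rw [← ht]
    apply PartialEquiv.left_inv
    rw [h1]
    rw [extChartAt_source, TangentBundle.mem_chart_source_iff]
    exact mem_chart_source E w.1.1
  · have : HasFDerivWithinAt (fun t : ℝ => ((extChartAt 𝓘(ℝ, E) w.1.1 w.1.1, aff w u t) : E × E)) ((0 : ℝ →L[ℝ] E).prod ((ContinuousLinearMap.id ℝ ℝ).smulRight (show E from u))) (Set.range 𝓘(ℝ, ℝ)) (0:ℝ) := by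
      apply HasFDerivAt.hasFDerivWithinAt
      exact (hasFDerivAt_const _ _).prodMk (aff_deriv _ _)
    have key2 : ∀ᶠ t in 𝓝 (0:ℝ), writtenInExtChartAt 𝓘(ℝ, ℝ) 𝓘(ℝ, E).tangent 0 (line w u) t = (extChartAt 𝓘(ℝ, E) w.1.1 w.1.1, aff w u t) := by
      filter_upwards [key] with t ht
      rw [← ht]
      unfold writtenInExtChartAt
      rw [line_zero]
      rfl
    refine this.congr_of_eventuallyEq (key2.filter_mono nhdsWithin_le_nhds) key2.self_of_nhds

theorem vlift_eq (w : Slit E M) (u : TangentSpace 𝓘(ℝ, E) (proj w)) : vlift w u = ((0, u) : E × E) := by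
  unfold vlift
  rw [(hline w u).mfderiv]
  have : ∀ (w' : Slit E M) (h : w' = w) (ξ : E × E), (h ▸ (show TangentSpace 𝓘(ℝ, E).tangent w' from ξ) : TangentSpace 𝓘(ℝ, E).tangent w) = ξ := by
    rintro _ rfl _; rfl
  refine (this _ (line_zero w u) _).trans ?_
  exact Prod.ext rfl (one_smul ℝ (show E from u))

theorem vlift_injective (w : Slit E M) : Function.Injective (vlift w) := by
  intro u v h
  rw [vlift_eq, vlift_eq] at h
  exact congrArg Prod.snd h

theorem exists_vlift_eq_iff (w : Slit E M) (ξ : TangentSpace 𝓘(ℝ, E).tangent w) :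
    (∃ u, vlift w u = ξ) ↔ dproj w ξ = 0 := by
  constructor
  · rintro ⟨u, rfl⟩
    rw [vlift_eq]
    exact dproj_eq w _
  · intro h
    have h' : (show E × E from ξ).1 = 0 := (dproj_eq w ξ).symm.trans h
    refine ⟨(show E × E from ξ).2, (vlift_eq w _).trans ?_⟩
    exact Prod.ext h'.symm rfl

/-- The inverse `i_w⁻¹` of the vertical lift (meaningful on vertical vectors). -/
def vliftInv (w : Slit E M) (ξ : TangentSpace 𝓘(ℝ, E).tangent w) :
    TangentSpace 𝓘(ℝ, E) (proj w) :=
  Function.invFun (vlift w) ξ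

/-- The canonical vector field `C(w) = i_w(w)`. -/
def canonical : VField E M := fun w => vlift w (vec w)

/-- The almost-tangent structure `𝒥(X) = i_w(dπ(X))`. -/
def almostTangent (X : VField E M) : VField E M := fun w => vlift w (dproj w (X w))

/-- `S` is a spray: a smooth vector field on `TM \ 0` with `𝒥(S) = C` and `[C, S] = S`. -/
structure IsSpray (S : VField E M) : Prop where
  smooth : Smooth S
  almostTangent_eq : almostTangent S = canonical
  homogeneous : bracket canonical S = S

/-- The canonical connection `Γ_S = -[S, 𝒥]` of a spray, applied to a vector field; here
`[S, 𝒥](X) = [S, 𝒥 X] - 𝒥 [S, X]` is the Lie derivative of the tensor `𝒥` along `S`. -/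
def canonicalConnection (S X : VField E M) : VField E M :=
  -(bracket S (almostTangent X) - almostTangent (bracket S X))

/-- The value of `X` at `w` is horizontal, i.e. it lies in `ker (Γ_S - I)`. -/
def HorizontalAt (S X : VField E M) (w : Slit E M) : Prop :=
  canonicalConnection S X w = X w

variable (E M) in
/-- A linear connection on the vertical bundle `𝒱TM → TM \ 0`: an operator `(X, Z) ↦ ∇_X Z`, for
smooth vector fields `X` and smooth sections `Z` of `𝒱TM` (smooth vertical fields), with values in
the smooth sections of `𝒱TM`, which is `C^∞`-linear in `X`, additive in `Z` and satisfies the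
Leibniz rule. The values of `cov` on other arguments are irrelevant. -/
structure VerticalConnection where
  cov : VField E M → VField E M → VField E M
  smooth_cov : ∀ X Z, Smooth X → Smooth Z → Vertical Z → Smooth (cov X Z)
  vertical_cov : ∀ X Z, Smooth X → Smooth Z → Vertical Z → Vertical (cov X Z)
  add_left : ∀ X Y Z, Smooth X → Smooth Y → Smooth Z → Vertical Z →
    cov (X + Y) Z = cov X Z + cov Y Z
  smul_left : ∀ (f : Slit E M → ℝ) (X Z : VField E M),
    ContMDiff 𝓘(ℝ, E).tangent 𝓘(ℝ, ℝ) ∞ f → Smooth X → Smooth Z → Vertical Z →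
    cov (fun w => f w • X w) Z = fun w => f w • cov X Z w
  add_right : ∀ X Y Z, Smooth X → Smooth Y → Vertical Y → Smooth Z → Vertical Z →
    cov X (Y + Z) = cov X Y + cov X Z
  leibniz : ∀ (f : Slit E M → ℝ) (X Z : VField E M),
    ContMDiff 𝓘(ℝ, E).tangent 𝓘(ℝ, ℝ) ∞ f → Smooth X → Smooth Z → Vertical Z →
    cov X (fun w => f w • Z w) =
      fun w => (show ℝ from mfderiv 𝓘(ℝ, E).tangent 𝓘(ℝ, ℝ) f w (X w)) • Z w + f w • cov X Z w

namespace VerticalConnection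

/-- `∇` is almost-projectable: `∇_X C = X` for all vertical `X`. -/
def AlmostProjectable (D : VerticalConnection E M) : Prop :=
  ∀ X, Smooth X → Vertical X → D.cov X canonical = X

/-- `∇` is a lift of `Γ_S`: it is almost-projectable and the kernel of `X ↦ ∇_X C` is the
horizontal bundle of `Γ_S`. -/
structure IsLift (D : VerticalConnection E M) (S : VField E M) : Prop where
  almostProjectable : D.AlmostProjectable
  ker_eq : ∀ X, Smooth X → ∀ w, D.cov X canonical w = 0 ↔ HorizontalAt S X w

/-- The torsion `T(X, Y) = ∇_X 𝒥Y - ∇_Y 𝒥X - 𝒥[X, Y]`. -/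
def torsion (D : VerticalConnection E M) (X Y : VField E M) : VField E M :=
  D.cov X (almostTangent Y) - D.cov Y (almostTangent X) - almostTangent (bracket X Y)

/-- Condition (T1): `T(S, Y) = 0` for all `Y`. -/
def T1 (D : VerticalConnection E M) (S : VField E M) : Prop :=
  ∀ Y, Smooth Y → D.torsion S Y = 0

/-- The curvature `ℛ(X, Y)Z = ∇_{[X,Y]} Z - [∇_X, ∇_Y] Z`, for vertical `Z`. -/
def curvature (D : VerticalConnection E M) (X Y Z : VField E M) : VField E M :=
  D.cov (bracket X Y) Z - (D.cov X (D.cov Y Z) - D.cov Y (D.cov X Z))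

end VerticalConnection

/-- `X` is a smooth vector field on `TM \ 0` whose value at `w` is a lift of `u`. -/
def IsLiftAt (X : VField E M) (w : Slit E M) (u : TangentSpace 𝓘(ℝ, E) (proj w)) : Prop :=
  Smooth X ∧ dproj w (X w) = u

/-- `X` is a smooth vector field on `TM \ 0` whose value at `w` is the horizontal lift `u^h`. -/
def IsHorizontalLiftAt (S X : VField E M) (w : Slit E M)
    (u : TangentSpace 𝓘(ℝ, E) (proj w)) : Prop :=
  IsLiftAt X w u ∧ HorizontalAt S X w

open Classical in
/-- A smooth vector field on `TM \ 0` extending the horizontal lift `u^h` of `u` at `w`. -/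
def horizontalExtension (S : VField E M) (w : Slit E M) (u : TangentSpace 𝓘(ℝ, E) (proj w)) :
    VField E M :=
  epsilon fun X => IsHorizontalLiftAt S X w u

/-- The curvature endomorphism `R_w(u) = i_w⁻¹ ℛ(S, u^h) C`. The tensor `ℛ` is evaluated at `w`
through an extension of `u^h` to a smooth vector field. -/
def curvatureEndomorphism (D : VerticalConnection E M) (S : VField E M) (w : Slit E M)
    (u : TangentSpace 𝓘(ℝ, E) (proj w)) : TangentSpace 𝓘(ℝ, E) (proj w) :=
  vliftInv w (D.curvature S (horizontalExtension S w u) canonical w)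

end SprayCurvature

end

/-! Put `v = (1/2)(I - Γ_S)`. For a spray, `𝒥[S, V] = -V` on vertical fields `V`; hence `𝒥 Γ_S = 𝒥`,
`Γ_S = -1` on vertical fields, `Γ_S² = I`, and `v` is the projection onto the vertical bundle along
the horizontal one. Also `Γ_S S = [C, S] = S`. A lift is therefore forced on `C`: `∇_X C = v X`
(`cov_canonical`). Since `∇_S C = v S = 0`, this gives `ℛ(S, X)C = v[S, X] - ∇_S(v X)`
(`curvature_canonical`).

Both terms pick up the same `(Sf) v X` when `X` becomes `f X`, so the expression is tensorial in `X`
and may be evaluated through any extension. On a field that is horizontal everywhere it equals `v[S,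
X]`, which involves only `S`: this is independence of the lift.

Under (T1), `∇_S 𝒥Y = v Y + 𝒥[S, Y]`. The definition of `Γ_S` gives the same value for `v[S, 𝒥Y]`,
so `ℛ(S, 𝒥Y)C = 0`. Every vertical vector is the value of some `𝒥Y`; by tensoriality the vertical
part of `X` does not contribute. -/

noncomputable section

namespace SprayCurvature

/-! ### Global smooth sections of vector bundles and Hadamard-type decompositions. -/

section Sections

open Bundle

/-- The total space of a fibre bundle with Hausdorff base and model fibre is Hausdorff. -/
theorem t2Space_totalSpace {B : Type*} [TopologicalSpace B] [T2Space B]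
    (F : Type*) [TopologicalSpace F] [T2Space F] (V : B → Type*)
    [TopologicalSpace (TotalSpace F V)] [∀ b, TopologicalSpace (V b)] [FiberBundle F V] :
    T2Space (TotalSpace F V) := by
  refine ⟨fun p q hpq => ?_⟩
  by_cases h : p.1 = q.1
  · let e := trivializationAt F V p.1
    have hp : p ∈ e.source := by
      rw [e.mem_source]; exact FiberBundle.mem_baseSet_trivializationAt' _
    have hq : q ∈ e.source := by
      rw [e.mem_source, ← h]; exact FiberBundle.mem_baseSet_trivializationAt' _
    obtain ⟨u, v, hu, hv, hpu, hqv, huv⟩ := t2_separation (fun h' => hpq (e.injOn hp hq h'))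
    refine ⟨e.source ∩ e ⁻¹' u, e.source ∩ e ⁻¹' v, e.continuousOn.isOpen_inter_preimage
      e.open_source hu, e.continuousOn.isOpen_inter_preimage e.open_source hv,
      ⟨hp, hpu⟩, ⟨hq, hqv⟩, ?_⟩
    exact (huv.preimage e).mono Set.inter_subset_right Set.inter_subset_right
  · exact separated_by_continuous (FiberBundle.continuous_proj F V) h

variable {H : Type*} [NormedAddCommGroup H] [NormedSpace ℝ H] [FiniteDimensional ℝ H]
  {K : Type*} [TopologicalSpace K] {I : ModelWithCorners ℝ H K}
  {B : Type*} [TopologicalSpace B] [T2Space B] [ChartedSpace K B] [IsManifold I ∞ B]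
  {F : Type*} [NormedAddCommGroup F] [NormedSpace ℝ F]
  {V : B → Type*} [TopologicalSpace (TotalSpace F V)] [∀ b, AddCommGroup (V b)]
  [∀ b, Module ℝ (V b)] [∀ b, TopologicalSpace (V b)]
  [FiberBundle F V] [VectorBundle ℝ F V]

/-- A smooth bump function at `x` supported in a given neighbourhood of `x`. -/
theorem exists_contMDiff_bump {x : B} {u : Set B} (hu : u ∈ 𝓝 x) :
    ∃ f : B → ℝ, ContMDiff I 𝓘(ℝ, ℝ) ∞ f ∧ tsupport f ⊆ u ∧ f x = 1 := by
  obtain ⟨f, -, hf⟩ := (SmoothBumpFunction.nhds_basis_tsupport (I := I) x).mem_iff.1 hu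
  exact ⟨f, f.contMDiff, hf, f.eq_one⟩

/-- Every vector of a smooth vector bundle is the value of a global smooth section. -/
theorem exists_contMDiff_section_eq [ContMDiffVectorBundle ∞ F V I] {x : B} (v : V x) :
    ∃ s : ∀ b, V b, ContMDiff I (I.prod 𝓘(ℝ, F)) ∞ (fun b => TotalSpace.mk' F b (s b)) ∧
      s x = v := by
  obtain ⟨u, hu, hs⟩ := FiberBundle.exists_contMDiffOn_extend I F (k := ∞) v
  obtain ⟨f, hf, hfu, hfx⟩ := exists_contMDiff_bump (I := I) (interior_mem_nhds.2 hu)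
  refine ⟨f • FiberBundle.extend F v, ContMDiffOn.smul_section_of_tsupport hf.contMDiffOn
    isOpen_interior hfu (hs.mono interior_subset), ?_⟩
  simp [hfx]

/-- A smooth section vanishing at `x` is a global finite sum of products of smooth functions
vanishing at `x` and smooth sections. -/
theorem exists_sum_smul_section_eq [FiniteDimensional ℝ F] [ContMDiffVectorBundle ∞ F V I]
    {x : B} {s : ∀ b, V b}
    (hs : ContMDiff I (I.prod 𝓘(ℝ, F)) ∞ (fun b => TotalSpace.mk' F b (s b))) (hx : s x = 0) :
    ∃ (n : ℕ) (f : Fin n → B → ℝ) (t : Fin n → ∀ b, V b),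
      (∀ i, ContMDiff I 𝓘(ℝ, ℝ) ∞ (f i)) ∧ (∀ i, f i x = 0) ∧
      (∀ i, ContMDiff I (I.prod 𝓘(ℝ, F)) ∞ (fun b => TotalSpace.mk' F b (t i b))) ∧
      s = fun b => ∑ i, f i b • t i b := by
  have : ContMDiffVectorBundle 1 F V I := ContMDiffVectorBundle.of_le (n := ∞) (by simp)
  let e := trivializationAt F V x
  let c := Module.finBasis ℝ F
  have hxe : x ∈ e.baseSet := FiberBundle.mem_baseSet_trivializationAt' x
  obtain ⟨φ, hφ, hφu, hφx⟩ := exists_contMDiff_bump (I := I) (e.open_baseSet.mem_nhds hxe)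
  let a : Fin (Module.finrank ℝ F) → B → ℝ := fun i b => e.localFrameCoeff I c i b (s b)
  have ha : ∀ i, ContMDiff I 𝓘(ℝ, ℝ) ∞ (φ • a i) := fun i => by
    refine contMDiff_of_tsupport fun b hb => ?_
    have hb' : b ∈ e.baseSet := hφu (closure_mono (Function.support_smul_subset_left φ (a i)) hb)
    exact hφ.contMDiffAt.smul (contMDiffAt_localFrameCoeff c hb' (hs b) i)
  have ht : ∀ i, ContMDiff I (I.prod 𝓘(ℝ, F)) ∞
      (fun b => TotalSpace.mk' F b ((φ • e.localFrame c i) b)) := fun i =>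
    ContMDiffOn.smul_section_of_tsupport hφ.contMDiffOn e.open_baseSet hφu
      (e.contMDiffOn_localFrame_baseSet ∞ c i)
  -- With a local frame `e i`, coefficients `a i` and a bump `φ` equal to 1 at `x`, the global
  -- identity is `s = (1 - φ²) s + ∑ (φ a i)(φ e i)`. One factor `φ` makes the coefficient globally
  -- smooth, the other the frame section.
  refine ⟨Module.finrank ℝ F + 1, Fin.cons (fun b => 1 - φ b * φ b) (fun i => φ • a i),
    Fin.cons s (fun i => φ • e.localFrame c i), ?_, ?_, ?_, ?_⟩
  · refine Fin.cases ?_ fun i => ?_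
    · exact contMDiff_const.sub (hφ.mul hφ)
    · exact ha i
  · refine Fin.cases ?_ fun i => ?_
    · simp [hφx]
    · simp [a, hx]
  · refine Fin.cases ?_ fun i => ?_
    · exact hs
    · exact ht i
  · funext b
    rw [Fin.sum_univ_succ]
    simp only [Fin.cons_zero, Fin.cons_succ, smul_eq_mul]
    by_cases hb : b ∈ e.baseSet
    · have h := e.eq_sum_localFrameCoeff_smul (I := I) (b := c) (s := s) hb
      have h2 : ∑ i, (φ b * a i b) • φ b • e.localFrame c i b = (φ b * φ b) • s b := by
        conv_rhs => rw [h]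
        rw [Finset.smul_sum]
        refine Finset.sum_congr rfl fun i _ => ?_
        rw [smul_smul, smul_smul]
        congr 1
        ring
      change s b = _ + ∑ i, (φ b * a i b) • φ b • e.localFrame c i b
      rw [h2, ← add_smul]
      simp
    · have h0 : φ b = 0 := image_eq_zero_of_notMem_tsupport fun h => hb (hφu h)
      simp [h0]

end Sections

variable {E : Type*} [NormedAddCommGroup E] [NormedSpace ℝ E]
  {M : Type*} [TopologicalSpace M] [ChartedSpace E M] [IsManifold 𝓘(ℝ, E) ∞ M]

/-! ### The preferred charts of the slit tangent bundle and their derivatives. -/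

section Charts

/-- The derivative at `w` of the preferred chart of `TM \ 0` at `w₀`. -/
def chartDeriv (w₀ w : Slit E M) : E × E →L[ℝ] E × E :=
  mfderiv 𝓘(ℝ, E).tangent 𝓘(ℝ, E × E) (extChartAt 𝓘(ℝ, E).tangent w₀) w

variable (E) in
/-- The derivative at `x` of the preferred chart of `M` at `x₀`. -/
def baseDeriv (x₀ x : M) : E →L[ℝ] E :=
  mfderiv 𝓘(ℝ, E) 𝓘(ℝ, E) (extChartAt 𝓘(ℝ, E) x₀) x

theorem mem_chart_source_iff (w₀ w : Slit E M) :
    w ∈ (chartAt (ModelProd E E) w₀).source ↔ proj w ∈ (chartAt E (proj w₀)).source := by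
  rw [TopologicalSpace.Opens.chartAt_eq, OpenPartialHomeomorph.subtypeRestr_source]
  exact TangentBundle.mem_chart_source_iff (I := 𝓘(ℝ, E)) w.1 w₀.1

theorem hasMFDerivAt_extChartAt_slit {w₀ w : Slit E M} (h : w ∈ (chartAt (ModelProd E E) w₀).source) :
    HasMFDerivAt 𝓘(ℝ, E).tangent 𝓘(ℝ, E × E) (extChartAt 𝓘(ℝ, E).tangent w₀) w
      (chartDeriv w₀ w) :=
  (mdifferentiableAt_extChartAt (I := 𝓘(ℝ, E).tangent) h).hasMFDerivAt

theorem extChartAt_slit_fst (w₀ w : Slit E M) :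
    (extChartAt 𝓘(ℝ, E).tangent w₀ w).1 = extChartAt 𝓘(ℝ, E) (proj w₀) (proj w) := rfl

theorem baseDeriv_eq_tangentCoordChange {x₀ x : M} (h : x ∈ (chartAt E x₀).source) :
    baseDeriv E x₀ x = tangentCoordChange 𝓘(ℝ, E) x x₀ x := by
  unfold baseDeriv
  rw [← TangentBundle.continuousLinearMapAt_trivializationAt h,
    TangentBundle.continuousLinearMapAt_trivializationAt_eq_core h]

theorem extChartAt_slit_snd {w₀ w : Slit E M} (h : w ∈ (chartAt (ModelProd E E) w₀).source) :
    (extChartAt 𝓘(ℝ, E).tangent w₀ w).2 = baseDeriv E (proj w₀) (proj w) (vec w) := by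
  rw [baseDeriv_eq_tangentCoordChange ((mem_chart_source_iff _ _).1 h)]
  rfl

theorem hasMFDerivAt_proj (w : Slit E M) :
    HasMFDerivAt 𝓘(ℝ, E).tangent 𝓘(ℝ, E) (proj : Slit E M → M) w (dproj w) := by
  have h : MDifferentiableAt 𝓘(ℝ, E).tangent 𝓘(ℝ, E) (proj : Slit E M → M) w :=
    (Bundle.mdifferentiableAt_proj (TangentSpace 𝓘(ℝ, E))).comp w (hval w).mdifferentiableAt
  exact h.hasMFDerivAt

theorem chartDeriv_fst {w₀ w : Slit E M} (h : w ∈ (chartAt (ModelProd E E) w₀).source)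
    (ξ : TangentSpace 𝓘(ℝ, E).tangent w) :
    (chartDeriv w₀ w ξ).1 = baseDeriv E (proj w₀) (proj w) (dproj w ξ) := by
  have h1 : HasMFDerivAt 𝓘(ℝ, E).tangent 𝓘(ℝ, E)
      (fun v : Slit E M => (extChartAt 𝓘(ℝ, E).tangent w₀ v).1) w
      ((ContinuousLinearMap.fst ℝ E E).comp (chartDeriv w₀ w)) :=
    (ContinuousLinearMap.fst ℝ E E).hasMFDerivAt.comp w (hasMFDerivAt_extChartAt_slit h)
  have h2 : HasMFDerivAt 𝓘(ℝ, E).tangent 𝓘(ℝ, E)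
      (fun v : Slit E M => extChartAt 𝓘(ℝ, E) (proj w₀) (proj v)) w
      ((baseDeriv E (proj w₀) (proj w)).comp (dproj w)) :=
    (mdifferentiableAt_extChartAt (I := 𝓘(ℝ, E))
      ((mem_chart_source_iff w₀ w).1 h)).hasMFDerivAt.comp w (hasMFDerivAt_proj w)
  exact DFunLike.congr_fun (hasMFDerivAt_unique h1 h2) ξ

/-- The chart is linear on fibres, so it sends `t ↦ w + t u` to a line with constant base component
and direction given by `baseDeriv`. -/
theorem chartDeriv_vlift {w₀ w : Slit E M} (h : w ∈ (chartAt (ModelProd E E) w₀).source)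
    (u : TangentSpace 𝓘(ℝ, E) (proj w)) :
    chartDeriv w₀ w (vlift w u) = (0, baseDeriv E (proj w₀) (proj w) u) := by
  let L : E →L[ℝ] E := baseDeriv E (proj w₀) (proj w)
  have h1 : HasMFDerivAt 𝓘(ℝ, ℝ) 𝓘(ℝ, E × E)
      (fun t => extChartAt 𝓘(ℝ, E).tangent w₀ (line w u t)) 0
      ((chartDeriv w₀ w).comp ((0 : ℝ →L[ℝ] E).prod
        ((ContinuousLinearMap.id ℝ ℝ).smulRight (show E from u)))) := by
    refine HasMFDerivAt.comp (I' := 𝓘(ℝ, E).tangent) 0 ?_ (hline w u)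
    rw [line_zero]
    exact hasMFDerivAt_extChartAt_slit h
  have h2 : HasMFDerivAt 𝓘(ℝ, ℝ) 𝓘(ℝ, E × E)
      (fun t : ℝ => ((extChartAt 𝓘(ℝ, E) (proj w₀) (proj w), L (aff w u t)) : E × E)) 0
      ((0 : ℝ →L[ℝ] E).prod (L.comp
        ((ContinuousLinearMap.id ℝ ℝ).smulRight (show E from u)))) :=
    ((hasFDerivAt_const _ _).prodMk (L.hasFDerivAt.comp (0 : ℝ) (aff_deriv _ _))).hasMFDerivAt
  have h3 : (fun t => extChartAt 𝓘(ℝ, E).tangent w₀ (line w u t)) =ᶠ[𝓝 0]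
      (fun t : ℝ => ((extChartAt 𝓘(ℝ, E) (proj w₀) (proj w), L (aff w u t)) : E × E)) := by
    filter_upwards [line_ev w u] with t ht
    have hp : proj (line w u t) = proj w := by
      change (line w u t).1.1 = w.1.1
      rw [ht]; rfl
    have hsrc : line w u t ∈ (chartAt (ModelProd E E) w₀).source := by
      rw [mem_chart_source_iff, hp]
      exact (mem_chart_source_iff w₀ w).1 h
    refine Prod.ext ?_ ?_
    · rw [extChartAt_slit_fst, hp]
    · rw [extChartAt_slit_snd hsrc]
      unfold proj vec
      rw [ht]
      rfl
  have h4 := DFunLike.congr_fun (hasMFDerivAt_unique h1 (h2.congr_of_eventuallyEq h3)) (1 : ℝ)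
  have h5 : ((0 : ℝ →L[ℝ] E).prod ((ContinuousLinearMap.id ℝ ℝ).smulRight (show E from u))) (1 : ℝ)
      = (vlift w u : E × E) := by
    rw [vlift_eq]
    exact Prod.ext rfl (one_smul ℝ (show E from u))
  have h6 : ((0 : ℝ →L[ℝ] E).prod (L.comp
        ((ContinuousLinearMap.id ℝ ℝ).smulRight (show E from u)))) (1 : ℝ) = ((0, L u) : E × E) :=
    Prod.ext rfl (congrArg L (one_smul ℝ (show E from u)))
  rw [← h5]
  exact h4.trans h6

theorem chartDeriv_self (w : Slit E M) : chartDeriv w w = ContinuousLinearMap.id ℝ (E × E) :=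
  mfderiv_extChartAt_self (I := 𝓘(ℝ, E).tangent)

/-- The trivialization of the tangent bundle at `w₀` is the derivative of the chart at `w₀`, so
smoothness can be tested on the components of a field. -/
theorem smooth_iff_chartDeriv (X : VField E M) : Smooth X ↔ ∀ w₀ : Slit E M,
    ContMDiffAt 𝓘(ℝ, E).tangent 𝓘(ℝ, E × E) ∞ (fun w => chartDeriv w₀ w (X w)) w₀ := by
  refine forall_congr' fun w₀ => ?_
  refine (Bundle.contMDiffAt_section (F := E × E) (IB := 𝓘(ℝ, E).tangent)
    (E := (TangentSpace 𝓘(ℝ, E).tangent : Slit E M → Type _)) w₀).trans ?_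
  refine Filter.EventuallyEq.contMDiffAt_iff ?_
  filter_upwards [(chartAt (ModelProd E E) w₀).open_source.mem_nhds (mem_chart_source _ w₀)]
    with w hw
  have h := TangentBundle.continuousLinearMapAt_trivializationAt (I := 𝓘(ℝ, E).tangent) hw
  have h' := DFunLike.congr_fun h (X w)
  refine Eq.trans ?_ h'
  rw [Bundle.Trivialization.continuousLinearMapAt_apply,
    Bundle.Trivialization.coe_linearMapAt_of_mem]
  rw [TangentBundle.trivializationAt_baseSet]
  exact hw

end Charts

/-! ### Smoothness of `C` and `𝒥`, and the bracket of a semispray with a vertical field. -/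

section Tensors

theorem chart_source_mem_nhds (w : Slit E M) : ∀ᶠ v in 𝓝 w, v ∈ (chartAt (ModelProd E E) w).source :=
  (chartAt (ModelProd E E) w).open_source.mem_nhds (mem_chart_source _ w)

theorem smooth_canonical : Smooth (canonical : VField E M) := by
  refine (smooth_iff_chartDeriv _).2 fun w₀ => ?_
  have h : ContMDiffAt 𝓘(ℝ, E).tangent 𝓘(ℝ, E × E) ∞
      (extChartAt 𝓘(ℝ, E).tangent w₀) w₀ := contMDiffAt_extChartAt
  have h2 := (((0 : E × E →L[ℝ] E).prod (ContinuousLinearMap.snd ℝ E E)).contMDiff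
    (n := ∞)).contMDiffAt.comp w₀ h
  refine h2.congr_of_eventuallyEq ?_
  filter_upwards [chart_source_mem_nhds w₀] with w hw
  change chartDeriv w₀ w (vlift w (vec w)) = (0, (extChartAt 𝓘(ℝ, E).tangent w₀ w).2)
  rw [chartDeriv_vlift hw, extChartAt_slit_snd hw]

theorem chartDeriv_almostTangent {w₀ w : Slit E M} (hw : w ∈ (chartAt (ModelProd E E) w₀).source)
    (X : VField E M) :
    chartDeriv w₀ w (almostTangent X w) = (0, (chartDeriv w₀ w (X w)).1) :=
  (chartDeriv_vlift hw _).trans (congrArg (Prod.mk 0) (chartDeriv_fst hw _).symm)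

theorem smooth_almostTangent {X : VField E M} (hX : Smooth X) : Smooth (almostTangent X) := by
  refine (smooth_iff_chartDeriv _).2 fun w₀ => ?_
  have h2 := (((0 : E × E →L[ℝ] E).prod (ContinuousLinearMap.fst ℝ E E)).contMDiff
    (n := ∞)).contMDiffAt.comp w₀ ((smooth_iff_chartDeriv X).1 hX w₀)
  refine h2.congr_of_eventuallyEq ?_
  filter_upwards [chart_source_mem_nhds w₀] with w hw
  exact chartDeriv_almostTangent hw X

/-- A vector field read in the preferred chart at `w₀`. -/
def inChart (w₀ : Slit E M) (X : VField E M) : E × E → E × E :=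
  VectorField.mpullbackWithin 𝓘(ℝ, E × E) 𝓘(ℝ, E).tangent
    (extChartAt 𝓘(ℝ, E).tangent w₀).symm X (Set.range 𝓘(ℝ, E).tangent)

theorem inChart_apply {w₀ : Slit E M} (X : VField E M) {w : Slit E M}
    (hw : w ∈ (chartAt (ModelProd E E) w₀).source) :
    inChart w₀ X (extChartAt 𝓘(ℝ, E).tangent w₀ w) = chartDeriv w₀ w (X w) := by
  have hw' : w ∈ (extChartAt 𝓘(ℝ, E).tangent w₀).source := by rwa [extChartAt_source]
  have h1 := mfderiv_extChartAt_comp_mfderivWithin_extChartAt_symm' (I := 𝓘(ℝ, E).tangent) hw'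
  have h2 := mfderivWithin_extChartAt_symm_comp_mfderiv_extChartAt' (I := 𝓘(ℝ, E).tangent) hw'
  -- The round trip through the chart yields a point equal to `w` only propositionally; abstracting
  -- it allows rewriting inside the dependent value of `X`.
  have h3 : ∀ w', w' = w → chartDeriv w₀ w (X w') = chartDeriv w₀ w (X w) := by
    rintro _ rfl; rfl
  refine (DFunLike.congr_fun (ContinuousLinearMap.inverse_eq h2 h1)
    (X ((extChartAt 𝓘(ℝ, E).tangent w₀).symm (extChartAt 𝓘(ℝ, E).tangent w₀ w)))).trans ?_
  exact h3 _ ((extChartAt 𝓘(ℝ, E).tangent w₀).left_inv hw')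

theorem extChartAt_symm_preimage_univ_inter_range (w : Slit E M) :
    (extChartAt 𝓘(ℝ, E).tangent w).symm ⁻¹' Set.univ ∩ Set.range 𝓘(ℝ, E).tangent = Set.univ := by
  rw [Set.preimage_univ, Set.univ_inter, ModelWithCorners.Boundaryless.range_eq_univ]

/-- The chart centred at `w` has identity derivative there, so the manifold bracket at `w` is the
flat one with no correction. -/
theorem bracket_eq_lieBracket (X Y : VField E M) (w : Slit E M) :
    bracket X Y w = VectorField.lieBracket ℝ (inChart w X) (inChart w Y)
      (extChartAt 𝓘(ℝ, E).tangent w w) := by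
  have h1 : chartDeriv w w = ContinuousLinearMap.id ℝ (E × E) := chartDeriv_self w
  have h2 : bracket X Y w = (chartDeriv w w).inverse (VectorField.lieBracketWithin ℝ (inChart w X)
      (inChart w Y) ((extChartAt 𝓘(ℝ, E).tangent w).symm ⁻¹' Set.univ ∩
        Set.range 𝓘(ℝ, E).tangent) (extChartAt 𝓘(ℝ, E).tangent w w)) := rfl
  rw [h2, h1, ContinuousLinearMap.inverse_id, extChartAt_symm_preimage_univ_inter_range,
    VectorField.lieBracketWithin_univ]
  rfl

theorem differentiableAt_inChart [CompleteSpace E] {X : VField E M} (hX : Smooth X)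
    (w : Slit E M) :
    DifferentiableAt ℝ (inChart w X) (extChartAt 𝓘(ℝ, E).tangent w w) := by
  have h := MDifferentiableWithinAt.differentiableWithinAt_mpullbackWithin_vectorField
    (I := 𝓘(ℝ, E).tangent) (V := X) (s := Set.univ) (x := w)
    ((hX w).mdifferentiableAt (by simp)).mdifferentiableWithinAt
  rw [extChartAt_symm_preimage_univ_inter_range] at h
  exact differentiableWithinAt_univ.1 h

theorem eventually_inChart_eq (w : Slit E M) {P : E × E → E × E → Prop} {X : VField E M}
    (h : ∀ v ∈ (chartAt (ModelProd E E) w).source,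
      P (extChartAt 𝓘(ℝ, E).tangent w v) (chartDeriv w v (X v))) :
    ∀ᶠ p in 𝓝 (extChartAt 𝓘(ℝ, E).tangent w w), P p (inChart w X p) := by
  filter_upwards [extChartAt_target_mem_nhds (I := 𝓘(ℝ, E).tangent) w] with p hp
  have hs := (extChartAt 𝓘(ℝ, E).tangent w).map_target hp
  rw [extChartAt_source] at hs
  have := h _ hs
  rwa [← inChart_apply X hs, (extChartAt 𝓘(ℝ, E).tangent w).right_inv hp] at this

/-- For a semispray `S` and a vertical field `V`, the vertical lift of `dπ [S, V]` is `-V`. -/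
theorem almostTangent_bracket_of_vertical [CompleteSpace E] {S V : VField E M} (hS : Smooth S)
    (hJS : almostTangent S = canonical) (hV : Smooth V) (hv : Vertical V) :
    almostTangent (bracket S V) = -V := by
  funext w
  -- Near the chart centre, with fibre coordinate `y`, `V = (0, V₂)`, and `𝒥S = C` reads `S = (y,
  -- S₂)`. The first component of `[S, V] = DV(S) - DS(V)` is thus `-V₂`.
  have hVz : ∀ᶠ p in 𝓝 (extChartAt 𝓘(ℝ, E).tangent w w), (inChart w V p).1 = 0 := by
    refine eventually_inChart_eq w (P := fun _ ξ => ξ.1 = 0) fun v hvs => ?_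
    rw [chartDeriv_fst hvs, hv]
    exact map_zero (baseDeriv E (proj w) (proj v))
  have hSz : ∀ᶠ p in 𝓝 (extChartAt 𝓘(ℝ, E).tangent w w), (inChart w S p).1 = p.2 := by
    refine eventually_inChart_eq w (P := fun p ξ => ξ.1 = p.2) fun v hvs => ?_
    have h := chartDeriv_almostTangent hvs S
    rw [hJS, canonical, chartDeriv_vlift hvs, ← extChartAt_slit_snd hvs] at h
    exact (congrArg Prod.snd h).symm
  have hSw := inChart_apply S (mem_chart_source (ModelProd E E) w)
  have hVw := inChart_apply V (mem_chart_source (ModelProd E E) w)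
  rw [chartDeriv_self] at hSw hVw
  have h1 : HasFDerivAt (fun p => (inChart w V p).1) (0 : E × E →L[ℝ] E)
      (extChartAt 𝓘(ℝ, E).tangent w w) :=
    (hasFDerivAt_const (0 : E) _).congr_of_eventuallyEq hVz
  have h1' := h1.unique (differentiableAt_inChart hV w).hasFDerivAt.fst
  have h2 : HasFDerivAt (fun p => (inChart w S p).1) (ContinuousLinearMap.snd ℝ E E)
      (extChartAt 𝓘(ℝ, E).tangent w w) :=
    hasFDerivAt_snd.congr_of_eventuallyEq hSz
  have h2' := h2.unique (differentiableAt_inChart hS w).hasFDerivAt.fst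
  have hb : (show E × E from bracket S V w).1 = -(show E × E from V w).2 := by
    rw [bracket_eq_lieBracket]
    have e1 := DFunLike.congr_fun h1' (inChart w S (extChartAt 𝓘(ℝ, E).tangent w w))
    have e2 := DFunLike.congr_fun h2' (inChart w V (extChartAt 𝓘(ℝ, E).tangent w w))
    change (fderiv ℝ (inChart w V) _ _).1 - (fderiv ℝ (inChart w S) _ _).1 = _
    refine (congrArg₂ (· - ·) e1.symm e2.symm).trans ?_
    rw [hVw]
    exact zero_sub _
  have hv1 : (show E × E from V w).1 = 0 := (dproj_eq w (V w)).symm.trans (hv w)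
  unfold almostTangent
  rw [vlift_eq]
  refine Prod.ext ?_ ?_
  · change (0 : E) = -(show E × E from V w).1
    rw [hv1, neg_zero]
  · exact (dproj_eq w _).trans hb

end Tensors

/-! ### Algebra of vector fields, brackets and `𝒥`. -/

section Fields

variable {X Y : VField E M} {f : Slit E M → ℝ}

theorem Smooth.add (hX : Smooth X) (hY : Smooth Y) : Smooth (X + Y) := ContMDiff.add_section hX hY

theorem Smooth.neg (hX : Smooth X) : Smooth (-X) := ContMDiff.neg_section hX

theorem Smooth.sub (hX : Smooth X) (hY : Smooth Y) : Smooth (X - Y) := ContMDiff.sub_section hX hY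

theorem Smooth.smul (hf : ContMDiff 𝓘(ℝ, E).tangent 𝓘(ℝ, ℝ) ∞ f) (hX : Smooth X) :
    Smooth (fun w => f w • X w) := ContMDiff.smul_section hf hX

theorem Smooth.const_smul (c : ℝ) (hX : Smooth X) : Smooth (c • X) :=
  ContMDiff.const_smul_section hX

theorem Smooth.mdifferentiableAt (hX : Smooth X) (w : Slit E M) :
    MDifferentiableAt 𝓘(ℝ, E).tangent 𝓘(ℝ, E).tangent.tangent
      (fun w => (⟨w, X w⟩ : TangentBundle 𝓘(ℝ, E).tangent (Slit E M))) w :=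
  (hX w).mdifferentiableAt (by simp)

theorem Smooth.bracket [CompleteSpace E] (hX : Smooth X) (hY : Smooth Y) :
    Smooth (bracket X Y) := fun w => by
  -- At smoothness `∞` the derivative lost by the bracket costs nothing: `∞ + 1` is `∞`.
  have : IsManifold 𝓘(ℝ, E).tangent (((⊤ : ℕ∞) : WithTop ℕ∞) + 1) (Slit E M) :=
    inferInstanceAs (IsManifold 𝓘(ℝ, E).tangent ∞ (Slit E M))
  have : IsManifold 𝓘(ℝ, E).tangent (minSmoothness ℝ 2) (Slit E M) := by
    rw [minSmoothness_of_isRCLikeNormedField]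
    infer_instance
  exact ContMDiffAt.mlieBracket_vectorField (m := ⊤) (n := ⊤) (hX w) (hY w) (by simp)

theorem bracket_swap (X Y : VField E M) : bracket X Y = -bracket Y X :=
  VectorField.mlieBracket_swap

theorem bracket_add_right [CompleteSpace E] (Z : VField E M) (hX : Smooth X) (hY : Smooth Y) :
    bracket Z (X + Y) = bracket Z X + bracket Z Y :=
  funext fun w => VectorField.mlieBracket_add_right (hX.mdifferentiableAt w)
    (hY.mdifferentiableAt w)

theorem bracket_smul_right [CompleteSpace E] (Z : VField E M)
    (hf : ContMDiff 𝓘(ℝ, E).tangent 𝓘(ℝ, ℝ) ∞ f) (hX : Smooth X) :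
    bracket Z (fun w => f w • X w) = fun w =>
      (show ℝ from mfderiv 𝓘(ℝ, E).tangent 𝓘(ℝ, ℝ) f w (Z w)) • X w + f w • bracket Z X w :=
  funext fun w => VectorField.mlieBracket_smul_right (hf.mdifferentiableAt (by simp))
    (hX.mdifferentiableAt w)

/-- In the identification of `T_w(TM \ 0)` with `E × E`, `𝒥` is `(a, b) ↦ (0, a)`; its pointwise
linearity follows from this. -/
theorem almostTangent_apply (X : VField E M) (w : Slit E M) :
    almostTangent X w = ((0, (show E × E from X w).1) : E × E) := by
  refine (vlift_eq w _).trans (congrArg (Prod.mk (0 : E)) (dproj_eq w _))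

theorem almostTangent_add (X Y : VField E M) :
    almostTangent (X + Y) = almostTangent X + almostTangent Y := by
  funext w
  rw [Pi.add_apply, almostTangent_apply, almostTangent_apply, almostTangent_apply]
  exact Prod.ext (add_zero (0 : E)).symm rfl

theorem almostTangent_smul (f : Slit E M → ℝ) (X : VField E M) :
    almostTangent (fun w => f w • X w) = fun w => f w • almostTangent X w := by
  funext w
  rw [almostTangent_apply, almostTangent_apply]
  exact Prod.ext (smul_zero (A := E) (f w)).symm rfl

theorem dproj_eq_iff (X Y : VField E M) (w : Slit E M) :
    almostTangent X w = almostTangent Y w ↔ dproj w (X w) = dproj w (Y w) :=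
  (vlift_injective w).eq_iff

theorem vertical_almostTangent (X : VField E M) : Vertical (almostTangent X) := fun w =>
  (exists_vlift_eq_iff w _).1 ⟨_, rfl⟩

theorem almostTangent_zero : almostTangent (0 : VField E M) = 0 :=
  funext fun w => almostTangent_apply 0 w

theorem almostTangent_eq_zero_iff : almostTangent X = 0 ↔ Vertical X := by
  refine funext_iff.trans (forall_congr' fun w => ?_)
  rw [← almostTangent_zero, dproj_eq_iff, Pi.zero_apply, map_zero]

theorem almostTangent_neg (X : VField E M) : almostTangent (-X) = -almostTangent X := by
  have h := almostTangent_add X (-X)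
  rw [add_neg_cancel, almostTangent_zero] at h
  exact (neg_eq_of_add_eq_zero_right h.symm).symm

theorem vertical_canonical : Vertical (canonical : VField E M) := fun w =>
  (exists_vlift_eq_iff w _).1 ⟨_, rfl⟩

theorem Vertical.smul (f : Slit E M → ℝ) (hX : Vertical X) : Vertical (fun w => f w • X w) :=
  fun w => by rw [map_smul, hX w, smul_zero]

end Fields

/-! ### Extension of tangent vectors and the tensoriality criterion. -/

section Tensoriality

variable [FiniteDimensional ℝ E] [T2Space M]

/-- Smooth bump functions on `TM \ 0` require the Hausdorff property. -/
instance : T2Space (TangentBundle 𝓘(ℝ, E) M) := t2Space_totalSpace E _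

/-- Every tangent vector of `TM \ 0` extends to a smooth vector field. -/
theorem exists_smooth_eq (w : Slit E M) (ξ : TangentSpace 𝓘(ℝ, E).tangent w) :
    ∃ X : VField E M, Smooth X ∧ X w = ξ :=
  exists_contMDiff_section_eq (I := 𝓘(ℝ, E).tangent) (F := E × E) (x := w) ξ

/-- A vertical vector is the value of `𝒥 Y` for some smooth vector field `Y`. -/
theorem exists_almostTangent_eq (w : Slit E M) {ξ : TangentSpace 𝓘(ℝ, E).tangent w}
    (hξ : dproj w ξ = 0) : ∃ Y : VField E M, Smooth Y ∧ almostTangent Y w = ξ := by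
  obtain ⟨u, rfl⟩ := (exists_vlift_eq_iff w ξ).2 hξ
  obtain ⟨Y, hY, hYw⟩ := exists_smooth_eq w
    (show TangentSpace 𝓘(ℝ, E).tangent w from ((show E from u, (0 : E)) : E × E))
  refine ⟨Y, hY, congrArg (vlift w) ?_⟩
  rw [hYw]
  exact dproj_eq w _

/-- A `C^∞`-linear operator on vector fields vanishes on fields vanishing at the point. -/
theorem tensorial_eq_zero {A : Type*} [AddCommGroup A] [Module ℝ A] (w : Slit E M)
    (Φ : VField E M → A)
    (hadd : ∀ X Y, Smooth X → Smooth Y → Φ (X + Y) = Φ X + Φ Y)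
    (hsmul : ∀ (f : Slit E M → ℝ) (X : VField E M), ContMDiff 𝓘(ℝ, E).tangent 𝓘(ℝ, ℝ) ∞ f →
      Smooth X → Φ (fun w => f w • X w) = f w • Φ X)
    {X : VField E M} (hX : Smooth X) (hw : X w = 0) : Φ X = 0 := by
  obtain ⟨n, f, t, hf, hfw, ht, rfl⟩ :=
    exists_sum_smul_section_eq (I := 𝓘(ℝ, E).tangent) (F := E × E) hX hw
  have h0s : Smooth (0 : VField E M) := by
    have := hX.const_smul (0 : ℝ)
    rwa [zero_smul] at this
  have h0 : Φ 0 = 0 := by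
    have := hadd 0 0 h0s h0s
    rwa [add_zero, left_eq_add] at this
  suffices h : ∀ s : Finset (Fin n), Smooth (fun b => ∑ i ∈ s, f i b • t i b : VField E M) ∧
      Φ (fun b => ∑ i ∈ s, f i b • t i b) = 0 from (h Finset.univ).2
  classical
  intro s
  induction s using Finset.induction_on with
  | empty => exact ⟨h0s, h0⟩
  | insert i s hi ih =>
    have he : (fun b => ∑ j ∈ insert i s, f j b • t j b : VField E M) =
        (fun b => f i b • t i b) + fun b => ∑ j ∈ s, f j b • t j b :=
      funext fun b => Finset.sum_insert hi
    rw [he]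
    refine ⟨(Smooth.smul (hf i) (ht i)).add ih.1, ?_⟩
    rw [hadd _ _ (Smooth.smul (hf i) (ht i)) ih.1, hsmul _ _ (hf i) (ht i), ih.2, hfw, zero_smul,
      add_zero]

/-- The value at `w` of a `C^∞`-linear operator depends only on the value of the field at `w`. -/
theorem tensorial_congr {A : Type*} [AddCommGroup A] [Module ℝ A] (w : Slit E M)
    (Φ : VField E M → A)
    (hadd : ∀ X Y, Smooth X → Smooth Y → Φ (X + Y) = Φ X + Φ Y)
    (hsmul : ∀ (f : Slit E M → ℝ) (X : VField E M), ContMDiff 𝓘(ℝ, E).tangent 𝓘(ℝ, ℝ) ∞ f →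
      Smooth X → Φ (fun w => f w • X w) = f w • Φ X)
    {X Y : VField E M} (hX : Smooth X) (hY : Smooth Y) (hw : X w = Y w) : Φ X = Φ Y := by
  have h := tensorial_eq_zero w Φ hadd hsmul (hX.sub hY) (sub_eq_zero.2 hw)
  have h2 := hadd _ _ (hX.sub hY) hY
  rwa [sub_add_cancel, h, zero_add] at h2

end Tensoriality

/-! ### The canonical connection of a spray and its splitting. -/

section Spray

variable [CompleteSpace E] {S X Y : VField E M}

theorem smooth_canonicalConnection (hS : IsSpray S) (hX : Smooth X) :
    Smooth (canonicalConnection S X) :=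
  ((hS.smooth.bracket (smooth_almostTangent hX)).sub
    (smooth_almostTangent (hS.smooth.bracket hX))).neg

theorem canonicalConnection_add (S : VField E M) (hX : Smooth X) (hY : Smooth Y) :
    canonicalConnection S (X + Y) = canonicalConnection S X + canonicalConnection S Y := by
  unfold canonicalConnection
  rw [almostTangent_add, bracket_add_right _ (smooth_almostTangent hX) (smooth_almostTangent hY),
    bracket_add_right _ hX hY, almostTangent_add]
  abel

/-- The terms `(Sf) 𝒥X` produced by the two brackets cancel. -/
theorem canonicalConnection_smul (S : VField E M) {f : Slit E M → ℝ}
    (hf : ContMDiff 𝓘(ℝ, E).tangent 𝓘(ℝ, ℝ) ∞ f) (hX : Smooth X) :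
    canonicalConnection S (fun w => f w • X w) = fun w => f w • canonicalConnection S X w := by
  unfold canonicalConnection
  rw [almostTangent_smul, bracket_smul_right _ hf (smooth_almostTangent hX),
    bracket_smul_right _ hf hX]
  funext w
  have h : almostTangent (fun w => (show ℝ from mfderiv 𝓘(ℝ, E).tangent 𝓘(ℝ, ℝ) f w (S w)) • X w
      + f w • bracket S X w) w = (show ℝ from mfderiv 𝓘(ℝ, E).tangent 𝓘(ℝ, ℝ) f w (S w)) •
        almostTangent X w + f w • almostTangent (bracket S X) w := by
    have h1 := almostTangent_add
      (fun w => (show ℝ from mfderiv 𝓘(ℝ, E).tangent 𝓘(ℝ, ℝ) f w (S w)) • X w)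
      (fun w => f w • bracket S X w)
    rw [almostTangent_smul, almostTangent_smul] at h1
    exact congrFun h1 w
  have key : ∀ (c d : ℝ) (a b e : TangentSpace 𝓘(ℝ, E).tangent w),
      -(c • a + d • b - (c • a + d • e)) = d • -(b - e) := by
    intros
    module
  exact (congrArg (fun z => -(_ - z)) h).trans (key _ _ _ _ _)

/-- As `𝒥² = 0`, only `-𝒥[S, 𝒥X]` survives, and it equals `𝒥X` because `𝒥X` is vertical. -/
theorem almostTangent_canonicalConnection (hS : IsSpray S) (hX : Smooth X) :
    almostTangent (canonicalConnection S X) = almostTangent X := by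
  unfold canonicalConnection
  rw [neg_sub, sub_eq_add_neg, almostTangent_add, almostTangent_neg,
    almostTangent_eq_zero_iff.2 (vertical_almostTangent _),
    almostTangent_bracket_of_vertical hS.smooth hS.almostTangent_eq (smooth_almostTangent hX)
      (vertical_almostTangent _)]
  simp

theorem canonicalConnection_of_vertical (hS : IsSpray S) (hX : Smooth X) (hv : Vertical X) :
    canonicalConnection S X = -X := by
  unfold canonicalConnection
  have h0 : bracket S (0 : VField E M) = 0 := VectorField.mlieBracket_zero_right
  rw [almostTangent_eq_zero_iff.2 hv, h0,
    almostTangent_bracket_of_vertical hS.smooth hS.almostTangent_eq hX hv]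
  simp

/-- `Γ_S X - X` is vertical, so `Γ_S` changes its sign. -/
theorem canonicalConnection_canonicalConnection (hS : IsSpray S) (hX : Smooth X) :
    canonicalConnection S (canonicalConnection S X) = X := by
  have hΓ := smooth_canonicalConnection hS hX
  have hv : Vertical (canonicalConnection S X - X) := by
    rw [← almostTangent_eq_zero_iff, sub_eq_add_neg, almostTangent_add, almostTangent_neg,
      almostTangent_canonicalConnection hS hX, add_neg_cancel]
  have h1 := canonicalConnection_of_vertical hS (hΓ.sub hX) hv
  have h2 := canonicalConnection_add S (hΓ.sub hX) hX
  rw [sub_add_cancel, h1] at h2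
  rw [h2]
  abel

omit [CompleteSpace E] in
-- This is where homogeneity enters: `Γ_S S = -[S, C] = [C, S] = S`.
theorem canonicalConnection_self (hS : IsSpray S) : canonicalConnection S S = S := by
  have h0 : bracket S S = 0 := VectorField.mlieBracket_self
  unfold canonicalConnection
  rw [h0, almostTangent_zero, hS.almostTangent_eq, sub_zero,
    ← bracket_swap, hS.homogeneous]

/-- The vertical part of a vector field with respect to `Γ_S`. -/
def verticalPart (S X : VField E M) : VField E M := (1 / 2 : ℝ) • (X - canonicalConnection S X)

/-- The horizontal part of a vector field with respect to `Γ_S`. -/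
def horizontalPart (S X : VField E M) : VField E M := (1 / 2 : ℝ) • (X + canonicalConnection S X)

omit [CompleteSpace E] in
theorem horizontalPart_add_verticalPart (S X : VField E M) :
    horizontalPart S X + verticalPart S X = X := by
  unfold horizontalPart verticalPart
  module

theorem smooth_verticalPart (hS : IsSpray S) (hX : Smooth X) : Smooth (verticalPart S X) :=
  (hX.sub (smooth_canonicalConnection hS hX)).const_smul _

theorem smooth_horizontalPart (hS : IsSpray S) (hX : Smooth X) : Smooth (horizontalPart S X) :=
  (hX.add (smooth_canonicalConnection hS hX)).const_smul _

theorem vertical_verticalPart (hS : IsSpray S) (hX : Smooth X) : Vertical (verticalPart S X) := by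
  have hv : Vertical (X - canonicalConnection S X) := by
    rw [← almostTangent_eq_zero_iff, sub_eq_add_neg, almostTangent_add, almostTangent_neg,
      almostTangent_canonicalConnection hS hX, add_neg_cancel]
  exact hv.smul fun _ => (1 / 2 : ℝ)

theorem verticalPart_add (S : VField E M) (hX : Smooth X) (hY : Smooth Y) :
    verticalPart S (X + Y) = verticalPart S X + verticalPart S Y := by
  unfold verticalPart
  rw [canonicalConnection_add S hX hY]
  module

theorem verticalPart_smul (S : VField E M) {f : Slit E M → ℝ}
    (hf : ContMDiff 𝓘(ℝ, E).tangent 𝓘(ℝ, ℝ) ∞ f) (hX : Smooth X) :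
    verticalPart S (fun w => f w • X w) = fun w => f w • verticalPart S X w := by
  unfold verticalPart
  rw [canonicalConnection_smul S hf hX]
  funext w
  simp only [Pi.smul_apply, Pi.sub_apply]
  module

theorem verticalPart_of_vertical (hS : IsSpray S) (hX : Smooth X) (hv : Vertical X) :
    verticalPart S X = X := by
  unfold verticalPart
  rw [canonicalConnection_of_vertical hS hX hv]
  module

theorem canonicalConnection_horizontalPart (hS : IsSpray S) (hX : Smooth X) :
    canonicalConnection S (horizontalPart S X) = horizontalPart S X := by
  have hΓ := smooth_canonicalConnection hS hX
  have h := canonicalConnection_smul S (f := fun _ => (1 / 2 : ℝ)) contMDiff_const (hX.add hΓ)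
  rw [canonicalConnection_add S hX hΓ, canonicalConnection_canonicalConnection hS hX] at h
  refine h.trans ?_
  rw [add_comm]
  rfl

theorem verticalPart_canonicalConnection (hS : IsSpray S) (hX : Smooth X) :
    verticalPart S (canonicalConnection S X) = -verticalPart S X := by
  unfold verticalPart
  rw [canonicalConnection_canonicalConnection hS hX]
  module

omit [CompleteSpace E] in
theorem verticalPart_eq_zero (h : canonicalConnection S X = X) : verticalPart S X = 0 := by
  unfold verticalPart
  rw [h, sub_self, smul_zero]

theorem almostTangent_horizontalPart (hS : IsSpray S) (hX : Smooth X) :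
    almostTangent (horizontalPart S X) = almostTangent X := by
  have h := almostTangent_add (horizontalPart S X) (verticalPart S X)
  rw [horizontalPart_add_verticalPart, almostTangent_eq_zero_iff.2 (vertical_verticalPart hS hX),
    add_zero] at h
  exact h.symm

/-- Apply `v` to `[S, 𝒥X] = 𝒥[S, X] - Γ_S X`, using `v 𝒥 = 𝒥` and `v Γ_S = -v`. The result is the
value that (T1) imposes on `∇_S 𝒥X`. -/
theorem verticalPart_bracket_almostTangent (hS : IsSpray S) (hX : Smooth X) :
    verticalPart S (bracket S (almostTangent X)) =
      verticalPart S X + almostTangent (bracket S X) := by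
  have hΓ := smooth_canonicalConnection hS hX
  have hJ := smooth_almostTangent (hS.smooth.bracket hX)
  have h1 : bracket S (almostTangent X) = almostTangent (bracket S X) +
      -canonicalConnection S X := by
    unfold canonicalConnection
    abel
  have h2 : verticalPart S (-canonicalConnection S X) = verticalPart S X := by
    have h := verticalPart_add S hΓ hΓ.neg
    rw [add_neg_cancel, verticalPart_canonicalConnection hS hX] at h
    have h0 : verticalPart S (0 : VField E M) = 0 :=
      (verticalPart_of_vertical hS (by simpa using hX.const_smul 0) fun w => map_zero _)
    rw [h0] at h
    exact (neg_add_eq_zero.1 h.symm).symm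
  rw [h1, verticalPart_add S hJ hΓ.neg, h2,
    verticalPart_of_vertical hS hJ (vertical_almostTangent _), add_comm]

/-- A horizontal vector is determined by its projection. -/
theorem eq_of_isHorizontalLiftAt [FiniteDimensional ℝ E] [T2Space M] (hS : IsSpray S)
    {w : Slit E M} {u : TangentSpace 𝓘(ℝ, E) (proj w)} (hX : IsHorizontalLiftAt S X w u)
    (hY : IsHorizontalLiftAt S Y w u) : X w = Y w := by
  have hD := hX.1.1.sub hY.1.1
  have hDw : dproj w ((X - Y) w) = 0 := by
    rw [Pi.sub_apply, map_sub, hX.1.2, hY.1.2, sub_self]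
  -- `X - Y` is vertical only at `w`; tensoriality of `Γ_S` allows replacing it by the everywhere
  -- vertical `𝒥Z`. Then `Γ_S` acts on the difference at `w` both as `-1` and as `+1`, so the
  -- difference vanishes.
  obtain ⟨Z, hZ, hZw⟩ := exists_almostTangent_eq w hDw
  have h1 := tensorial_congr w (fun X => canonicalConnection S X w)
    (fun X Y hX hY => congrFun (canonicalConnection_add S hX hY) w)
    (fun f X hf hX => congrFun (canonicalConnection_smul S hf hX) w)
    (smooth_almostTangent hZ) hD hZw
  have h2 := congrFun (canonicalConnection_add S hD hY.1.1) w
  rw [sub_add_cancel, hX.2, Pi.add_apply, hY.2] at h2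
  rw [canonicalConnection_of_vertical hS (smooth_almostTangent hZ) (vertical_almostTangent Z),
    Pi.neg_apply, hZw] at h1
  rw [← h1, Pi.sub_apply] at h2
  have h3 : (2 : ℝ) • (X w - Y w) = 0 := by
    rw [two_smul]
    nth_rewrite 1 [h2]
    abel
  exact sub_eq_zero.1 ((smul_eq_zero.1 h3).resolve_left two_ne_zero)

end Spray

/-! ### Curvature of a lift evaluated on `C`. -/

section Lifts

variable {S X : VField E M} {D : VerticalConnection E M}

theorem Smooth.zero : Smooth (0 : VField E M) := by
  simpa using smooth_canonical.const_smul 0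

/-- The derivative of a smooth function along a smooth vector field is smooth. -/
theorem contMDiff_mfderiv_apply {f : Slit E M → ℝ}
    (hf : ContMDiff 𝓘(ℝ, E).tangent 𝓘(ℝ, ℝ) ∞ f) (hX : Smooth X) :
    ContMDiff 𝓘(ℝ, E).tangent 𝓘(ℝ, ℝ) ∞
      (fun w => (show ℝ from mfderiv 𝓘(ℝ, E).tangent 𝓘(ℝ, ℝ) f w (X w))) :=
  (contMDiff_snd_tangentBundle_modelSpace ℝ 𝓘(ℝ, ℝ)).comp
    ((hf.contMDiff_tangentMap (m := ∞) (by simp)).comp hX)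

theorem VerticalConnection.cov_zero (D : VerticalConnection E M) (hX : Smooth X) :
    D.cov X 0 = 0 := by
  have h := D.add_right X 0 0 hX Smooth.zero (fun w => map_zero _) Smooth.zero fun w => map_zero _
  rwa [add_zero, left_eq_add] at h

variable [CompleteSpace E]

/-- For a lift of `Γ_S`, the derivative `∇_X C` is the vertical part of `X`. -/
theorem VerticalConnection.IsLift.cov_canonical (hD : D.IsLift S) (hS : IsSpray S)
    (hX : Smooth X) : D.cov X canonical = verticalPart S X := by
  have h1 := D.add_left _ _ canonical (smooth_horizontalPart hS hX) (smooth_verticalPart hS hX)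
    smooth_canonical vertical_canonical
  have h2 : D.cov (horizontalPart S X) canonical = 0 := funext fun w =>
    (hD.ker_eq _ (smooth_horizontalPart hS hX) w).2
      (congrFun (canonicalConnection_horizontalPart hS hX) w)
  rwa [horizontalPart_add_verticalPart, h2, zero_add,
    hD.almostProjectable _ (smooth_verticalPart hS hX) (vertical_verticalPart hS hX)] at h1

theorem VerticalConnection.IsLift.curvature_canonical (hD : D.IsLift S) (hS : IsSpray S)
    (hX : Smooth X) : D.curvature S X canonical =
      verticalPart S (bracket S X) - D.cov S (verticalPart S X) := by
  unfold VerticalConnection.curvature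
  rw [hD.cov_canonical hS (hS.smooth.bracket hX), hD.cov_canonical hS hX,
    hD.cov_canonical hS hS.smooth, verticalPart_eq_zero (canonicalConnection_self hS),
    D.cov_zero hX, sub_zero]

theorem VerticalConnection.IsLift.vertical_curvature (hD : D.IsLift S) (hS : IsSpray S)
    (hX : Smooth X) : Vertical (D.curvature S X canonical) := fun w => by
  rw [hD.curvature_canonical hS hX, Pi.sub_apply, map_sub,
    vertical_verticalPart hS (hS.smooth.bracket hX) w,
    D.vertical_cov _ _ hS.smooth (smooth_verticalPart hS hX) (vertical_verticalPart hS hX) w,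
    sub_zero]

theorem VerticalConnection.IsLift.curvature_add (hD : D.IsLift S) (hS : IsSpray S)
    {Y : VField E M} (hX : Smooth X) (hY : Smooth Y) :
    D.curvature S (X + Y) canonical = D.curvature S X canonical + D.curvature S Y canonical := by
  rw [hD.curvature_canonical hS hX, hD.curvature_canonical hS hY,
    hD.curvature_canonical hS (hX.add hY), bracket_add_right S hX hY,
    verticalPart_add S (hS.smooth.bracket hX) (hS.smooth.bracket hY), verticalPart_add S hX hY,
    D.add_right _ _ _ hS.smooth (smooth_verticalPart hS hX) (vertical_verticalPart hS hX)
      (smooth_verticalPart hS hY) (vertical_verticalPart hS hY)]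
  abel

/-- The term `(Sf) v X` arises once from `v[S, fX]` and once from the Leibniz rule for `∇_S(f v X)`,
with opposite signs. -/
theorem VerticalConnection.IsLift.curvature_smul (hD : D.IsLift S) (hS : IsSpray S)
    {f : Slit E M → ℝ} (hf : ContMDiff 𝓘(ℝ, E).tangent 𝓘(ℝ, ℝ) ∞ f) (hX : Smooth X) :
    D.curvature S (fun w => f w • X w) canonical =
      fun w => f w • D.curvature S X canonical w := by
  have hc := contMDiff_mfderiv_apply hf hS.smooth
  have hb := hS.smooth.bracket hX
  have hv : verticalPart S (bracket S fun w => f w • X w) = fun w =>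
      (show ℝ from mfderiv 𝓘(ℝ, E).tangent 𝓘(ℝ, ℝ) f w (S w)) • verticalPart S X w +
        f w • verticalPart S (bracket S X) w := by
    have h := verticalPart_add S (hX.smul hc) (hb.smul hf)
    rw [verticalPart_smul S hc hX, verticalPart_smul S hf hb] at h
    rw [bracket_smul_right S hf hX]
    exact h
  rw [hD.curvature_canonical hS (hX.smul hf), hD.curvature_canonical hS hX, hv,
    verticalPart_smul S hf hX, D.leibniz f _ _ hf hS.smooth (smooth_verticalPart hS hX)
      (vertical_verticalPart hS hX)]
  funext w
  exact (add_sub_add_left_eq_sub _ _ _).trans (smul_sub _ _ _).symm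

/-- `ℛ(S, X) C` at `w` depends only on the value of `X` at `w`. -/
theorem VerticalConnection.IsLift.curvature_congr [FiniteDimensional ℝ E] [T2Space M]
    (hD : D.IsLift S) (hS : IsSpray S) {Y : VField E M} {w : Slit E M}
    (hX : Smooth X) (hY : Smooth Y) (hw : X w = Y w) :
    D.curvature S X canonical w = D.curvature S Y canonical w :=
  tensorial_congr w (fun X => D.curvature S X canonical w)
    (fun _ _ hX hY => congrFun (hD.curvature_add hS hX hY) w)
    (fun _ _ hf hX => congrFun (hD.curvature_smul hS hf hX) w) hX hY hw

/-- The connection drops out because `v` annihilates the whole field, not just its value at one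
point. -/
theorem VerticalConnection.IsLift.curvature_horizontalPart (hD : D.IsLift S) (hS : IsSpray S)
    (hX : Smooth X) : D.curvature S (horizontalPart S X) canonical =
      verticalPart S (bracket S (horizontalPart S X)) := by
  rw [hD.curvature_canonical hS (smooth_horizontalPart hS hX),
    verticalPart_eq_zero (canonicalConnection_horizontalPart hS hX), D.cov_zero hS.smooth, sub_zero]

theorem VerticalConnection.IsLift.curvature_almostTangent (hD : D.IsLift S) (hS : IsSpray S)
    (hT : D.T1 S) (hX : Smooth X) : D.curvature S (almostTangent X) canonical = 0 := by
  have hJ := smooth_almostTangent hX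
  have h := hT X hX
  unfold VerticalConnection.torsion at h
  rw [hS.almostTangent_eq, hD.cov_canonical hS hX, sub_sub, sub_eq_zero] at h
  rw [hD.curvature_canonical hS hJ, verticalPart_bracket_almostTangent hS hX,
    verticalPart_of_vertical hS hJ (vertical_almostTangent X), h, sub_self]

end Lifts

/-! ### The curvature endomorphism. -/

section Endomorphism

variable [CompleteSpace E] {S X : VField E M} {D : VerticalConnection E M}
  {w : Slit E M} {u : TangentSpace 𝓘(ℝ, E) (proj w)}

theorem IsLiftAt.horizontalPart (hS : IsSpray S) (hX : IsLiftAt X w u) :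
    IsHorizontalLiftAt S (horizontalPart S X) w u := by
  refine ⟨⟨smooth_horizontalPart hS hX.1, ?_⟩,
    congrFun (canonicalConnection_horizontalPart hS hX.1) w⟩
  rw [← hX.2, ← dproj_eq_iff, almostTangent_horizontalPart hS hX.1]

variable [FiniteDimensional ℝ E] [T2Space M]

theorem exists_isHorizontalLiftAt (hS : IsSpray S) (w : Slit E M)
    (u : TangentSpace 𝓘(ℝ, E) (proj w)) : ∃ X, IsHorizontalLiftAt S X w u := by
  obtain ⟨X, hX, hXw⟩ := exists_smooth_eq w
    (show TangentSpace 𝓘(ℝ, E).tangent w from ((show E from u, (0 : E)) : E × E))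
  have hXu : IsLiftAt X w u := by
    refine ⟨hX, ?_⟩
    rw [hXw]
    exact dproj_eq w _
  exact ⟨_, hXu.horizontalPart hS⟩

theorem isHorizontalLiftAt_horizontalExtension (hS : IsSpray S) (w : Slit E M)
    (u : TangentSpace 𝓘(ℝ, E) (proj w)) :
    IsHorizontalLiftAt S (horizontalExtension S w u) w u :=
  Classical.epsilon_spec (exists_isHorizontalLiftAt hS w u)

/-- The curvature value is vertical, so `vliftInv` is a genuine inverse there. The chosen extension
and `X` agree at `w`, and the curvature is tensorial. -/
theorem vlift_curvatureEndomorphism (hS : IsSpray S) (hD : D.IsLift S)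
    (hX : IsHorizontalLiftAt S X w u) :
    vlift w (curvatureEndomorphism D S w u) = D.curvature S X canonical w := by
  have hH := isHorizontalLiftAt_horizontalExtension hS w u
  refine (Function.invFun_eq ((exists_vlift_eq_iff w _).2
    (hD.vertical_curvature hS hH.1.1 w))).trans ?_
  exact hD.curvature_congr hS hH.1.1 hX.1.1 (eq_of_isHorizontalLiftAt hS hH hX)

theorem vlift_curvatureEndomorphism_of_T1 (hS : IsSpray S) (hD : D.IsLift S)
    (hT : D.T1 S) (hX : IsLiftAt X w u) :
    vlift w (curvatureEndomorphism D S w u) = D.curvature S X canonical w := by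
  rw [vlift_curvatureEndomorphism hS hD (hX.horizontalPart hS)]
  have hv := smooth_verticalPart hS hX.1
  obtain ⟨Y, hY, hYw⟩ := exists_almostTangent_eq w (vertical_verticalPart hS hX.1 w)
  have h := congrFun (hD.curvature_add hS (smooth_horizontalPart hS hX.1) hv) w
  rw [horizontalPart_add_verticalPart, Pi.add_apply,
    hD.curvature_congr hS hv (smooth_almostTangent hY) hYw.symm,
    hD.curvature_almostTangent hS hT hY, Pi.zero_apply, add_zero] at h
  exact h.symm

end Endomorphism

end SprayCurvature

end

theorem mainTheorem3 {E : Type*} [NormedAddCommGroup E] [NormedSpace ℝ E] [FiniteDimensional ℝ E]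
    {M : Type*} [TopologicalSpace M] [T2Space M] [ChartedSpace E M] [IsManifold 𝓘(ℝ, E) ∞ M]
    (S : SprayCurvature.VField E M) (hS : SprayCurvature.IsSpray S) :
    (∀ (w : SprayCurvature.Slit E M) (u : TangentSpace 𝓘(ℝ, E) (SprayCurvature.proj w)),
      ∃ X : SprayCurvature.VField E M, SprayCurvature.IsHorizontalLiftAt S X w u) ∧
    (∀ D : SprayCurvature.VerticalConnection E M, D.IsLift S →
      ∀ (w : SprayCurvature.Slit E M) (u : TangentSpace 𝓘(ℝ, E) (SprayCurvature.proj w))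
        (X : SprayCurvature.VField E M), SprayCurvature.IsHorizontalLiftAt S X w u →
        SprayCurvature.vlift w (SprayCurvature.curvatureEndomorphism D S w u) =
          D.curvature S X SprayCurvature.canonical w) ∧
    (∀ D D' : SprayCurvature.VerticalConnection E M, D.IsLift S → D'.IsLift S →
      ∀ (w : SprayCurvature.Slit E M) (u : TangentSpace 𝓘(ℝ, E) (SprayCurvature.proj w)),
        SprayCurvature.curvatureEndomorphism D S w u =
          SprayCurvature.curvatureEndomorphism D' S w u) ∧
    (∀ D : SprayCurvature.VerticalConnection E M, D.IsLift S → D.T1 S →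
      ∀ (w : SprayCurvature.Slit E M) (u : TangentSpace 𝓘(ℝ, E) (SprayCurvature.proj w))
        (X : SprayCurvature.VField E M), SprayCurvature.IsLiftAt X w u →
        SprayCurvature.vlift w (SprayCurvature.curvatureEndomorphism D S w u) =
          D.curvature S X SprayCurvature.canonical w) := by
  have : CompleteSpace E := FiniteDimensional.complete ℝ E
  refine ⟨SprayCurvature.exists_isHorizontalLiftAt hS,
    fun D hD w u X hX => SprayCurvature.vlift_curvatureEndomorphism hS hD hX,
    fun D D' hD hD' w u => SprayCurvature.vlift_injective w ?_,
    fun D hD hT w u X hX => SprayCurvature.vlift_curvatureEndomorphism_of_T1 hS hD hT hX⟩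
  obtain ⟨X, hX⟩ := SprayCurvature.exists_isHorizontalLiftAt hS w u
  -- `X` is horizontal only at `w`. Its horizontal part is horizontal everywhere, as the
  -- connection-free formula `v[S, ·]` requires.
  have hH := hX.1.horizontalPart hS
  rw [SprayCurvature.vlift_curvatureEndomorphism hS hD hH,
    SprayCurvature.vlift_curvatureEndomorphism hS hD' hH,
    hD.curvature_horizontalPart hS hX.1.1, hD'.curvature_horizontalPart hS hX.1.1]
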